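/- A cycle on $[N]=\{1,2,\dots,N\}$ is a permutation $\pi_1\pi_2\cdots\pi_N$ of $[N]$, written as a word and considered up to cyclic rotation; indices are read modulo $N$. A drop of the cycle is a pair $(\pi_i,\pi_{i+1})$ of cyclically consecutive entries, $1\le i\le N$, with $\pi_i>\pi_{i+1}$. It is odd-odd if both $\pi_i$ and $\pi_{i+1}$ are odd. Let $(h_n)_{n\ge 0}=(1,2,8,56,608,\dots)$ be the (unsigned) Genocchi medians, given by the formal power series identity $$1+\sum_{n\ge 1}h_{n-1}t^n=t^{-1}\sum_{m\ge 1}\frac{\big((m-1)!\big)^2t^m}{\prod_{k=1}^m\big(1+k(k-1)t\big)}.$$ Then for every $n\ge 2$, $h_{n-2}$ is equal to the number of cycles on $[2n-1]$ all of whose drops are odd-odd. -/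

import Mathlib

open PowerSeries in
/-- The `m`-th summand (`m ≥ 1`) of the generating function of the Genocchi medians,
`((m-1)!)² t^m / ∏_{k=1}^m (1 + k(k-1) t)`, as a formal power series over `ℤ`. Every factor of the
denominator has constant term `1`, and `invOfUnit _ 1` is its inverse. -/
noncomputable def medianTerm (m : ℕ) : PowerSeries ℤ :=
  C (((m - 1).factorial : ℤ) ^ 2) * X ^ m *
    ∏ k ∈ Finset.Icc 1 m, invOfUnit (1 + C ((k : ℤ) * ((k : ℤ) - 1)) * X) 1

open PowerSeries in
/-- `medianTerm m` is the announced quotient. -/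
theorem medianTerm_mul_prod (m : ℕ) :
    medianTerm m * ∏ k ∈ Finset.Icc 1 m, (1 + C ((k : ℤ) * ((k : ℤ) - 1)) * X) =
      C (((m - 1).factorial : ℤ) ^ 2) * X ^ m := by
  have h : ∀ k ∈ Finset.Icc 1 m,
      invOfUnit (1 + C ((k : ℤ) * ((k : ℤ) - 1)) * X) 1 *
        (1 + C ((k : ℤ) * ((k : ℤ) - 1)) * X) = 1 := by
    intro k _
    rw [mul_comm]
    exact mul_invOfUnit _ 1 (by simp)
  rw [medianTerm, mul_assoc, ← Finset.prod_mul_distrib, Finset.prod_congr rfl h]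
  simp

open PowerSeries in
/-- The `m`-th summand is divisible by `t^m`, so it does not contribute to lower coefficients. -/
theorem coeff_medianTerm_of_lt {N m : ℕ} (h : N < m) : coeff N (medianTerm m) = 0 := by
  have e : medianTerm m = X ^ m * (C (((m - 1).factorial : ℤ) ^ 2) *
      ∏ k ∈ Finset.Icc 1 m, invOfUnit (1 + C ((k : ℤ) * ((k : ℤ) - 1)) * X) 1) := by
    rw [medianTerm]; ring
  rw [e, coeff_X_pow_mul', if_neg (not_le.mpr h)]

/-- The formal power series `∑_{m ≥ 1} ((m-1)!)² t^m / ∏_{k=1}^m (1 + k(k-1) t)`. Its coefficient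
of `t^N` is a finite sum, as the summands with `m > N` do not contribute. -/
noncomputable def medianSeries : PowerSeries ℤ :=
  PowerSeries.mk fun N => ∑ m ∈ Finset.Icc 1 N, PowerSeries.coeff N (medianTerm m)

/-- The (unsigned) Genocchi medians `h_0, h_1, h_2, … = 1, 2, 8, 56, 608, …`, given by
`1 + ∑_{n ≥ 1} h_{n-1} t^n = t⁻¹ ∑_{m ≥ 1} ((m-1)!)² t^m / ∏_{k=1}^m (1 + k(k-1) t)`. -/
noncomputable def genocchiMedian (n : ℕ) : ℤ :=
  PowerSeries.coeff (n + 2) medianSeries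

open PowerSeries in
/-- The generating function identity that defines the Genocchi medians (multiplied by `t`). -/
theorem genocchiMedian_generatingFunction :
    X * (1 + X * PowerSeries.mk genocchiMedian) = medianSeries := by
  ext N
  match N with
  | 0 => simp [medianSeries]
  | 1 =>
    have h := congrArg (coeff 1) (medianTerm_mul_prod 1)
    simp only [Finset.Icc_self, Finset.prod_singleton] at h
    norm_num at h
    rw [show (1 : ℕ) = 0 + 1 from rfl, coeff_succ_X_mul]
    simp [medianSeries, h]
  | n + 2 =>
    rw [show n + 2 = (n + 1) + 1 from rfl, coeff_succ_X_mul, map_add, coeff_succ_X_mul]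
    simp [genocchiMedian, coeff_one]

/-- A cycle on `[n] = {1, …, n}`: a word that contains each of `1, …, n` exactly once and nothing
else, up to cyclic rotation. (`Cycle ℕ` is the quotient of `List ℕ` by rotation.) -/
def IsCycleOnInterval (n : ℕ) (c : Cycle ℕ) : Prop :=
  c.Nodup ∧ ∀ k : ℕ, k ∈ c ↔ 1 ≤ k ∧ k ≤ n

/-- `(a, b)` is a drop of the cycle `c`: `a` is immediately followed by `b`, cyclically, and
`a > b`. (That `b` follows `a` means that some representative word of `c` begins with `a b`.) -/
def IsDrop (c : Cycle ℕ) (a b : ℕ) : Prop :=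
  (∃ l : List ℕ, c = ((a :: b :: l : List ℕ) : Cycle ℕ)) ∧ b < a

/-- All drops of `c` are odd-odd: both entries are odd. -/
def OnlyOddOddDrops (c : Cycle ℕ) : Prop :=
  ∀ a b : ℕ, IsDrop c a b → Odd a ∧ Odd b

/-! Build cycles from the one-letter cycle 1 by inserting successive maxima. With `arcWeight`,
splitting an arc by a new maximum `v` differentiates its weight and multiplies by `insertFactor v`.
By the Leibniz rule, summing over all positions differentiates the product, so `cycleWeightSum`
obeys a recursion alternating `X * D` and `(1 + X)^2 * D`, and its value at `0` counts the good
cycles (`ncard_onlyOddOddDrops`). On the basis `shiftedPow`, two steps of the recursion act as `s_m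
↦ s_(m+1) - (m+1)(m+2) s_m`. The coefficients `medianCoeff` obey the dual recurrence, whence
`cycleWeightSum_eq_sum`; a last differentiation at `0` turns `s_m` into `(m+1)!^2`. -/

/-! ### Insertion of maxima and the differential recursion. -/

section ArcWeight

open Polynomial

/-- The weight of an arc `x → y`. Its value at `0` tells whether the arc is allowed, and its
derivative tells whether `y` is odd. -/
noncomputable def arcWeight (x y : ℕ) : ℤ[X] :=
  if Even y then (if x ≤ y then 1 else 0) else if Even x ∧ y < x then X else 1 + X

/-- The product of the weights of the arcs of the path `x → l → 1`. -/
noncomputable def pathWeight : ℕ → List ℕ → ℤ[X]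
  | x, [] => arcWeight x 1
  | x, y :: l => arcWeight x y * pathWeight y l

/-- The factor that belongs to the insertion of a new maximum `v`. -/
noncomputable def insertFactor (v : ℕ) : ℤ[X] :=
  if Even v then X else (1 + X) ^ 2

/-- The arc into `v` is never a drop and the arc out of it always is: an even `y` gives `0`, an odd
`y` gives a product independent of `x`. -/
theorem arcWeight_mul_arcWeight {x y v : ℕ} (hx : x < v) (hy : y < v) :
    arcWeight x v * arcWeight v y = insertFactor v * derivative (arcWeight x y) := by
  have hxv := hx.le
  have hvx := hx.not_gt
  have hvy := hy.not_ge
  unfold arcWeight insertFactor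
  by_cases h1 : Even y <;> by_cases h2 : Even v <;> by_cases h3 : Even x <;>
    by_cases h4 : y < x <;> by_cases h5 : x ≤ y <;>
    simp [*, sq]

theorem sum_pathWeight_permutations'Aux {v : ℕ} (hv : 1 < v) :
    ∀ {x : ℕ} {l : List ℕ}, x < v → (∀ y ∈ l, y < v) →
      ((l.permutations'Aux v).map (pathWeight x)).sum =
        insertFactor v * derivative (pathWeight x l)
  | x, [], hx, _ => by simpa [pathWeight] using arcWeight_mul_arcWeight hx hv
  | x, y :: l, hx, hl => by
    have hy : y < v := hl y (by simp)
    have ih := sum_pathWeight_permutations'Aux hv (l := l) hy fun z hz => hl z (by simp [hz])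
    have e := arcWeight_mul_arcWeight hx hy
    simp only [List.permutations'Aux, List.map_cons, List.map_map, List.sum_cons, pathWeight,
      Function.comp_def, List.sum_map_mul_left, ih, derivative_mul]
    linear_combination pathWeight y l * e

/-- The letters `m + 1, …, 3, 2`. -/
def lettersAboveOne : ℕ → List ℕ
  | 0 => []
  | m + 1 => (m + 2) :: lettersAboveOne m

theorem mem_lettersAboveOne {m k : ℕ} : k ∈ lettersAboveOne m ↔ 2 ≤ k ∧ k ≤ m + 1 := by
  induction m with
  | zero => simp [lettersAboveOne]; omega
  | succ m ih => simp only [lettersAboveOne, List.mem_cons, ih]; omega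

theorem nodup_lettersAboveOne (m : ℕ) : (lettersAboveOne m).Nodup := by
  induction m with
  | zero => simp [lettersAboveOne]
  | succ m ih => simp [lettersAboveOne, ih, mem_lettersAboveOne]

/-- The sum of the weights of all cycles on `[m + 1]`. -/
noncomputable def cycleWeightSum (m : ℕ) : ℤ[X] :=
  ((lettersAboveOne m).permutations'.map (pathWeight 1)).sum

theorem cycleWeightSum_zero : cycleWeightSum 0 = 1 + X := by
  simp [cycleWeightSum, lettersAboveOne, pathWeight, arcWeight]

theorem cycleWeightSum_succ (m : ℕ) :
    cycleWeightSum (m + 1) = insertFactor (m + 2) * derivative (cycleWeightSum m) := by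
  have key : ∀ L : List (List ℕ), (∀ l ∈ L, ∀ y ∈ l, y < m + 2) →
      ((L.flatMap (List.permutations'Aux (m + 2))).map (pathWeight 1)).sum =
        insertFactor (m + 2) * derivative (L.map (pathWeight 1)).sum := by
    intro L
    induction L with
    | nil => simp
    | cons l L ih =>
      intro h
      rw [List.flatMap_cons, List.map_append, List.sum_append, List.map_cons, List.sum_cons,
        derivative_add, mul_add, ih fun l' hl' => h l' (by simp [hl']),
        sum_pathWeight_permutations'Aux (by omega) (by omega) (h l (by simp))]
  refine key _ fun l hl y hy => ?_
  have := mem_lettersAboveOne.1 ((List.mem_permutations'.1 hl).mem_iff.1 hy)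
  omega

theorem cycleWeightSum_odd_succ (m : ℕ) :
    cycleWeightSum (2 * m + 1) = X * derivative (cycleWeightSum (2 * m)) := by
  rw [cycleWeightSum_succ, insertFactor, if_pos (by simp [parity_simps])]

theorem cycleWeightSum_even_succ (m : ℕ) :
    cycleWeightSum (2 * m + 2) = (1 + X) ^ 2 * derivative (cycleWeightSum (2 * m + 1)) := by
  rw [cycleWeightSum_succ, insertFactor, if_neg (by simp [parity_simps])]

end ArcWeight

/-! ### Solving the recursion in terms of the median series. -/

section Expansion

open Polynomial

/-- The coefficient of `t^(r+2)` in `t^(j+1) / ∏_{k=1}^{j+1} (1 + k(k-1) t)`. -/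
noncomputable def medianCoeff (r j : ℕ) : ℤ :=
  PowerSeries.coeff (r + 2) (PowerSeries.X ^ (j + 1) * ∏ k ∈ Finset.Icc 1 (j + 1),
    PowerSeries.invOfUnit (1 + PowerSeries.C ((k : ℤ) * ((k : ℤ) - 1)) * PowerSeries.X) 1)

theorem invOfUnit_linear_mul (a : ℤ) :
    PowerSeries.invOfUnit (1 + PowerSeries.C a * PowerSeries.X) 1 *
      (1 + PowerSeries.C a * PowerSeries.X) = 1 := by
  rw [mul_comm]
  exact PowerSeries.mul_invOfUnit _ 1 (by simp)

theorem medianCoeff_zero_right (r : ℕ) : medianCoeff r 0 = 0 := by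
  have h := invOfUnit_linear_mul 0
  simp only [map_zero, zero_mul, add_zero, mul_one] at h
  simp [medianCoeff, h, PowerSeries.coeff_X]

theorem medianCoeff_eq_zero {r j : ℕ} (h : r + 1 < j) : medianCoeff r j = 0 := by
  rw [medianCoeff, PowerSeries.coeff_X_pow_mul', if_neg (by omega)]

theorem medianCoeff_zero_one : medianCoeff 0 1 = 1 := by
  rw [medianCoeff, PowerSeries.coeff_X_pow_mul', if_pos (by omega)]
  simp [Finset.prod_Icc_succ_top]

/-- Clear the last denominator factor, with `k = j + 2`, and compare coefficients. -/
theorem medianCoeff_succ_succ (r j : ℕ) :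
    medianCoeff (r + 1) (j + 1) + (j + 1) * (j + 2) * medianCoeff r (j + 1) =
      medianCoeff r j := by
  have h := invOfUnit_linear_mul (((j + 1 + 1 : ℕ) : ℤ) * (((j + 1 + 1 : ℕ) : ℤ) - 1))
  set P := ∏ k ∈ Finset.Icc 1 (j + 1),
    PowerSeries.invOfUnit (1 + PowerSeries.C ((k : ℤ) * ((k : ℤ) - 1)) * PowerSeries.X) 1 with hP
  set I := PowerSeries.invOfUnit (1 + PowerSeries.C (((j + 1 + 1 : ℕ) : ℤ) *
    (((j + 1 + 1 : ℕ) : ℤ) - 1)) * PowerSeries.X) 1 with hI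
  have e : PowerSeries.X ^ (j + 1 + 1) * (P * I) + PowerSeries.X * (PowerSeries.C
      (((j + 1 + 1 : ℕ) : ℤ) * (((j + 1 + 1 : ℕ) : ℤ) - 1)) *
        (PowerSeries.X ^ (j + 1 + 1) * (P * I))) =
      PowerSeries.X * (PowerSeries.X ^ (j + 1) * P) := by
    linear_combination PowerSeries.X ^ (j + 2) * P * h
  have c := congrArg (PowerSeries.coeff (r + 2 + 1)) e
  rw [map_add, PowerSeries.coeff_succ_X_mul, PowerSeries.coeff_succ_X_mul,
    PowerSeries.coeff_C_mul] at c
  simp only [medianCoeff, Finset.prod_Icc_succ_top (show 1 ≤ j + 1 + 1 by omega), ← hP, ← hI]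
  rw [← c]
  push_cast
  ring_nf

/-- The polynomial `(m+1)! m! ((1+t)^(m+1) - 1)`. -/
noncomputable def shiftedPow (m : ℕ) : ℤ[X] :=
  (((m + 1).factorial * m.factorial : ℕ) : ℤ[X]) * ((1 + X) ^ (m + 1) - 1)

theorem operator_shiftedPow (m : ℕ) :
    X * derivative ((1 + X) ^ 2 * derivative (shiftedPow m)) =
      shiftedPow (m + 1) - (((m + 1) * (m + 2) : ℕ) : ℤ[X]) * shiftedPow m := by
  have d (k : ℕ) : derivative ((1 + X : ℤ[X]) ^ (k + 1)) = (k + 1 : ℤ[X]) * (1 + X) ^ k := by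
    simp [derivative_pow]
  have e : (1 + X) ^ 2 * derivative (shiftedPow m) =
      (((m + 1).factorial * m.factorial * (m + 1) : ℕ) : ℤ[X]) * (1 + X) ^ (m + 1 + 1) := by
    rw [shiftedPow, derivative_natCast_mul, derivative_sub, d]
    push_cast
    simp only [derivative_one]
    ring
  rw [e, derivative_natCast_mul, d, shiftedPow, shiftedPow, Nat.factorial_succ (m + 1),
    Nat.factorial_succ m]
  push_cast
  ring

theorem coeff_one_shiftedPow (m : ℕ) :
    (shiftedPow m).coeff 1 = ((m + 1).factorial : ℤ) ^ 2 := by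
  have h : ((1 + X : ℤ[X]) ^ (m + 1) - 1).coeff 1 = m + 1 := by
    rw [coeff_sub, coeff_one_add_X_pow]
    simp [coeff_one]
  rw [shiftedPow, ← nsmul_eq_mul, coeff_smul, h, Nat.factorial_succ]
  simp only [nsmul_eq_mul]
  push_cast
  ring

theorem cycleWeightSum_eq_sum (r : ℕ) :
    cycleWeightSum (2 * r + 1) =
      ∑ m ∈ Finset.range (r + 1), (medianCoeff r (m + 1) : ℤ[X]) * shiftedPow m := by
  induction r with
  | zero =>
    rw [cycleWeightSum_odd_succ]
    simp [cycleWeightSum_zero, medianCoeff_zero_one, shiftedPow]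
  | succ r ih =>
    have h0 : (medianCoeff r (r + 1 + 1) : ℤ[X]) = 0 := by
      rw [medianCoeff_eq_zero (by omega), Int.cast_zero]
    have h1 (m : ℕ) : (medianCoeff (r + 1) (m + 1) : ℤ[X]) =
        medianCoeff r m - (((m + 1) * (m + 2) : ℕ) : ℤ[X]) * medianCoeff r (m + 1) := by
      rw [← medianCoeff_succ_succ r m]
      push_cast
      ring
    rw [cycleWeightSum_odd_succ, show 2 * (r + 1) = 2 * r + 2 by ring, cycleWeightSum_even_succ,
      ih, derivative_sum, Finset.mul_sum, derivative_sum, Finset.mul_sum]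
    have h2 (m : ℕ) : X * derivative ((1 + X) ^ 2 *
        derivative ((medianCoeff r (m + 1) : ℤ[X]) * shiftedPow m)) =
        (medianCoeff r (m + 1) : ℤ[X]) * shiftedPow (m + 1) -
        (((m + 1) * (m + 2) : ℕ) : ℤ[X]) * (medianCoeff r (m + 1) : ℤ[X]) * shiftedPow m := by
      rw [derivative_intCast_mul, mul_left_comm, derivative_intCast_mul, mul_left_comm,
        operator_shiftedPow]
      ring
    simp only [h1, h2, sub_mul, Finset.sum_sub_distrib]
    -- The boundary terms of the shifted sums vanish because `medianCoeff r 0` and `medianCoeff r (r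
    -- + 2)` do.
    rw [Finset.sum_range_succ' (fun m => (medianCoeff r m : ℤ[X]) * shiftedPow m),
      Finset.sum_range_succ (fun m => (((m + 1) * (m + 2) : ℕ) : ℤ[X]) *
        (medianCoeff r (m + 1) : ℤ[X]) * shiftedPow m) (r + 1), h0, medianCoeff_zero_right]
    simp

theorem genocchiMedian_eq_sum (r : ℕ) :
    genocchiMedian r =
      ∑ m ∈ Finset.range (r + 1), medianCoeff r (m + 1) * ((m + 1).factorial : ℤ) ^ 2 := by
  have h (m : ℕ) : PowerSeries.coeff (r + 2) (medianTerm (m + 1)) =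
      medianCoeff r m * (m.factorial : ℤ) ^ 2 := by
    rw [medianTerm, mul_assoc, PowerSeries.coeff_C_mul, medianCoeff, mul_comm]
    rfl
  rw [genocchiMedian, medianSeries, PowerSeries.coeff_mk, ← Finset.Ico_add_one_right_eq_Icc,
    ← Finset.sum_Ico_add' _ 0 (r + 2) 1, ← Finset.range_eq_Ico, Finset.sum_range_succ']
  simp only [h, medianCoeff_zero_right, zero_mul, add_zero]

theorem eval_zero_cycleWeightSum (r : ℕ) :
    (cycleWeightSum (2 * r + 2)).eval 0 = genocchiMedian r := by
  have h : (cycleWeightSum (2 * r + 2)).eval 0 = (cycleWeightSum (2 * r + 1)).coeff 1 := by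
    rw [cycleWeightSum_even_succ, eval_mul, ← coeff_zero_eq_eval_zero (derivative _),
      coeff_derivative]
    simp
  rw [h, cycleWeightSum_eq_sum, finsetSum_coeff, genocchiMedian_eq_sum]
  refine Finset.sum_congr rfl fun m _ => ?_
  rw [← zsmul_eq_mul, coeff_smul, coeff_one_shiftedPow, smul_eq_mul]

end Expansion

/-! ### Cycles as words starting with 1. -/

section Counting

/-- An arc `a → b` that is not a drop, or is an odd-odd drop. -/
def IsAllowedArc (a b : ℕ) : Prop :=
  b < a → Odd a ∧ Odd b

open scoped Classical in
theorem eval_zero_arcWeight (x y : ℕ) :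
    (arcWeight x y).eval 0 = if IsAllowedArc x y then 1 else 0 := by
  unfold arcWeight IsAllowedArc
  by_cases h1 : Even y <;> by_cases h2 : Even x <;> by_cases h3 : y < x <;>
    simp [*, ← Nat.not_even_iff_odd, not_le.2, not_lt.1]

open scoped Classical in
theorem eval_zero_pathWeight (x : ℕ) (l : List ℕ) :
    (pathWeight x l).eval 0 = if List.IsChain IsAllowedArc (x :: (l ++ [1])) then 1 else 0 := by
  induction l generalizing x with
  | nil => simp [pathWeight, eval_zero_arcWeight]
  | cons y l ih =>
    simp only [pathWeight, Polynomial.eval_mul, ih, eval_zero_arcWeight, List.cons_append,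
      List.isChain_cons_cons, ite_and]
    split_ifs <;> simp

theorem onlyOddOddDrops_coe_cons (l : List ℕ) :
    OnlyOddOddDrops ((1 :: l : List ℕ) : Cycle ℕ) ↔
      List.IsChain IsAllowedArc (1 :: (l ++ [1])) := by
  constructor
  · intro h
    rw [List.isChain_iff_forall_rel_of_append_cons_cons]
    intro a b p q e hba
    refine h a b ⟨?_, hba⟩
    -- If `q` is empty, the pair is the closing arc into the final 1; otherwise it lies inside `1 ::
    -- l`.
    rcases List.eq_nil_or_concat' q with rfl | ⟨q, c, rfl⟩
    · have e' : 1 :: l ++ [1] = (p ++ [a]) ++ [b] := by simpa using e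
      obtain ⟨e1, e2⟩ := List.append_inj' e' rfl
      obtain rfl : 1 = b := by simpa using e2
      cases p with
      | nil =>
        simp at e1
        omega
      | cons d p =>
        obtain ⟨rfl, rfl⟩ : 1 = d ∧ l = p ++ [a] := by simpa using e1
        exact ⟨p, Cycle.coe_eq_coe.2 (List.isRotated_concat a (1 :: p))⟩
    · have e' : 1 :: l ++ [1] = (p ++ a :: b :: q) ++ [c] := by simpa using e
      obtain ⟨e1, -⟩ := List.append_inj' e' rfl
      exact ⟨q ++ p, Cycle.coe_eq_coe.2 (e1 ▸ List.isRotated_append)⟩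
  · rintro h a b ⟨⟨q, e⟩, hba⟩
    rw [← Cycle.chain_coe_cons, e, Cycle.chain_coe_cons] at h
    exact (List.isChain_cons_cons.1 h).1 hba

theorem exists_eq_coe_cons {c : Cycle ℕ} {a : ℕ} (h : a ∈ c) :
    ∃ l : List ℕ, c = ((a :: l : List ℕ) : Cycle ℕ) := by
  induction c using Quotient.inductionOn with
  | _ w =>
    obtain ⟨p, q, rfl⟩ := List.append_of_mem (Cycle.mem_coe_iff.1 h)
    exact ⟨q ++ p, Cycle.coe_eq_coe.2 List.isRotated_append⟩

theorem eq_of_isRotated_cons {a : ℕ} {l l' : List ℕ} (hl : (a :: l).Nodup)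
    (h : (a :: l) ~r (a :: l')) : l = l' := by
  obtain ⟨k, hk, e⟩ := List.isRotated_iff_mod.1 h
  -- Distinct letters force `k = 0`, except for the full rotation, which `hk` permits.
  rcases Nat.lt_or_ge k (a :: l).length with hk' | hk'
  · have h0 : ((a :: l).rotate k)[0]? = (a :: l)[k]? := by
      rw [List.getElem?_rotate (by simp), Nat.zero_add, Nat.mod_eq_of_lt hk']
    rw [e] at h0
    have h1 : (a :: l)[0]? = (a :: l)[k]? := by simpa using h0
    have := (List.getElem?_inj (by simp) hl).1 h1
    subst this
    simpa using e
  · obtain rfl : k = (a :: l).length := le_antisymm hk hk'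
    rw [List.rotate_length] at e
    simpa using e

theorem isCycleOnInterval_coe_cons {m : ℕ} {l : List ℕ} :
    IsCycleOnInterval (m + 1) ((1 :: l : List ℕ) : Cycle ℕ) ↔
      l ∈ (lettersAboveOne m).permutations' := by
  rw [List.mem_permutations', IsCycleOnInterval, Cycle.nodup_coe_iff, List.nodup_cons]
  simp only [Cycle.mem_coe_iff, List.mem_cons]
  constructor
  · rintro ⟨⟨h1, hl⟩, h⟩
    rw [List.perm_ext_iff_of_nodup hl (nodup_lettersAboveOne m)]
    intro k
    rw [mem_lettersAboveOne]
    constructor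
    · intro hk
      have := (h k).1 (Or.inr hk)
      have : k ≠ 1 := fun e => h1 (e ▸ hk)
      omega
    · intro hk
      exact ((h k).2 (by omega)).resolve_left (by omega)
  · intro h
    refine ⟨⟨fun h1 => ?_, h.nodup_iff.2 (nodup_lettersAboveOne m)⟩, fun k => ?_⟩
    · have := mem_lettersAboveOne.1 (h.mem_iff.1 h1)
      omega
    · rw [h.mem_iff, mem_lettersAboveOne]
      omega

theorem ncard_onlyOddOddDrops (m : ℕ) :
    (({c : Cycle ℕ | IsCycleOnInterval (m + 1) c ∧ OnlyOddOddDrops c}.ncard : ℕ) : ℤ) =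
      (cycleWeightSum m).eval 0 := by
  classical
  set S : Finset (List ℕ) := (lettersAboveOne m).permutations'.toFinset.filter
    fun l => List.IsChain IsAllowedArc (1 :: (l ++ [1])) with hS
  have himage : {c : Cycle ℕ | IsCycleOnInterval (m + 1) c ∧ OnlyOddOddDrops c} =
      (fun l : List ℕ => ((1 :: l : List ℕ) : Cycle ℕ)) '' S := by
    ext c
    simp only [Set.mem_ofPred_eq, Set.mem_image, hS, Finset.coe_filter, List.mem_toFinset]
    constructor
    · rintro ⟨h1, h2⟩
      obtain ⟨l, rfl⟩ := exists_eq_coe_cons ((h1.2 1).2 (by omega))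
      exact ⟨l, ⟨isCycleOnInterval_coe_cons.1 h1, (onlyOddOddDrops_coe_cons l).1 h2⟩, rfl⟩
    · rintro ⟨l, ⟨h1, h2⟩, rfl⟩
      exact ⟨isCycleOnInterval_coe_cons.2 h1, (onlyOddOddDrops_coe_cons l).2 h2⟩
  have hinj : Set.InjOn (fun l : List ℕ => ((1 :: l : List ℕ) : Cycle ℕ)) S := by
    intro l hl l' _ e
    have h := isCycleOnInterval_coe_cons.2 (List.mem_toFinset.1 (Finset.mem_filter.1 hl).1)
    exact eq_of_isRotated_cons (Cycle.nodup_coe_iff.1 h.1) (Cycle.coe_eq_coe.1 e)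
  have hnodup : (lettersAboveOne m).permutations'.Nodup :=
    (List.permutations_perm_permutations' _).nodup_iff.1
      (List.nodup_permutations _ (nodup_lettersAboveOne m))
  rw [himage, hinj.ncard_image, Set.ncard_coe_finset, hS, Finset.card_filter,
    Nat.cast_sum, List.sum_toFinset _ hnodup, cycleWeightSum, ← Polynomial.coe_evalRingHom,
    map_list_sum, List.map_map]
  congr 1
  refine List.map_congr_left fun l _ => ?_
  simp [eval_zero_pathWeight]

end Counting

theorem mainTheorem4 (n : ℕ) (hn : 2 ≤ n) :
    genocchiMedian (n - 2) =
      (({c : Cycle ℕ | IsCycleOnInterval (2 * n - 1) c ∧ OnlyOddOddDrops c}.ncard : ℕ) : ℤ) := by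
  obtain ⟨r, rfl⟩ := Nat.exists_eq_add_of_le' hn
  rw [show 2 * (r + 2) - 1 = 2 * r + 2 + 1 by omega, ncard_onlyOddOddDrops,
    eval_zero_cycleWeightSum, Nat.add_sub_cancel]
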